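/- **Theorem (local $L^2$ orthogonality).** Fix an integer $n\ge 1$ and let $\phi_n(t)=\left(1,\frac{t}{1!},\frac{t^2}{2!},\dots,\frac{t^n}{n!}\right)\in\mathbb R^{n+1}$. For a scale $s\in 2^{-\mathbb N}$ (with $\mathbb N=\{0,1,2,\dots\}$) let $$\mathcal J(s)=\{[\,l\,2^{-100n}s,(l+1)2^{-100n}s):\ l=0,\dots,2^{100n}s^{-1}-1\}.$$ Let $1\le r\le R$ with $r,R\in 2^{n\mathbb N}$, and let $\lambda$ be a dyadic number (an integer power of $2$) with $R^{-\frac{n-1}{n}}\le\lambda\le 1$. For each interval $I\in\mathcal J(R^{-1/n})$ with initial point $a$ let $$\theta=\Big\{\sum_{i=0}^n\lambda_i\phi_n^{(i)}(a):\ |\lambda_i|\le R^{-\frac in}\ (0\le i\le n),\ \max_{0\le i\le n-1}|\lambda_i|\ge\tfrac{\lambda}{2},\ \max_{0\le i\le n-1}|\lambda_i|2^{n-i}R^{\frac in}\ge 1\Big\},$$ write $I(\theta)=I$, and let $\Xi_{n-1}^{n+1}(R,\lambda)$ be the collection of these $\theta$, one for each $I$. Let $\psi:\mathbb R^{n+1}\to[0,\infty)$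 be a smooth radial function supported in $\{|\xi|\le 1\}$ with $|\check\psi(x)|>0$ for all $|x|\le 1$, where $\check\psi$ denotes the inverse Fourier transform. For an integer $d\ge 1$ put $$W^{n+1,d}(x)=\sum_{j=0}^\infty 2^{-100(n+1)^2jd}\,|\check\psi(2^{-j}x)|^2,$$ and for a ball $B$ with centre $b$ and radius $\rho$ put $W_B^{n+1,d}(x)=W^{n+1,d}(\rho^{-1}(x-b))$. Then there is a constant $C$ depending only on $n$ such that for all $\psi,d,r,R,\lambda$ as above, every ball $B\subset\mathbb R^{n+1}$ of radius $\lambda^{-1}r$, and all Schwartz functions $f_\theta:\mathbb R^{n+1}\to\mathbb C$ with $\operatorname{supp}\widehat f_\theta\subset\theta$ $(\theta\in\Xi_{n-1}^{n+1}(R,\lambda))$, $$\int_{\mathbb R^{n+1}}\Big|\sum_{\theta\in\Xi_{n-1}^{n+1}(R,\lambda)}f_\theta\Big|^2W_B^{n+1,d}\ \le\ C\int_{\mathbb R^{n+1}}\sum_{J\in\mathcal J(r^{-1/n})}\Big|\sum_{\substack{\theta\in\Xi_{n-1}^{n+1}(R,\lambda)\\ I(\theta)\subset J}}f_\theta\Big|^2W_B^{n+1,d}.$$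 -/

import Mathlib

open scoped FourierTransform ContDiff

/-- The curve `φ_n(t) = (1, t/1!, t²/2!, …, tⁿ/n!)` in Euclidean `ℝ^{n+1}`. -/
noncomputable def phi (n : ℕ) (t : ℝ) : EuclideanSpace ℝ (Fin (n + 1)) :=
  WithLp.toLp 2 fun k => t ^ (k : ℕ) / ((k : ℕ).factorial : ℝ)

/-- The scale `2^{nM}`, a typical element of `2^{nℕ}`. -/
noncomputable def dyadicScale (n M : ℕ) : ℝ := 2 ^ (n * M)

/-- Number of grid intervals of length `2^{-100n} R^{-1/n}` in `[0,1)`, for `R = 2^{nM}`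
(note `R^{1/n} = 2^M`). -/
def gridCount (n M : ℕ) : ℕ := 2 ^ (100 * n + M)

/-- The grid point `l · 2^{-100n} R^{-1/n}`, for `R = 2^{nM}`. -/
noncomputable def gridPoint (n M l : ℕ) : ℝ :=
  (l : ℝ) * ((2 ^ (100 * n))⁻¹ * dyadicScale n M ^ (-(1 / (n : ℝ))))

/-- The `l`-th grid interval. For `R = 2^{nM}` and `0 ≤ l < 2^{100n} R^{1/n}` these are the elements of
`𝒥(R^{-1/n})`, and they are also the intervals `I(θ)`. -/
noncomputable def gridInterval (n M l : ℕ) : Set ℝ :=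
  Set.Ico (gridPoint n M l) (gridPoint n M (l + 1))

/-- The truncated piece `θ` of the Taylor cone of order `n - 1` with initial point `a`:
the points `∑_{i ≤ n} λ_i φ_n^{(i)}(a)` with `|λ_i| ≤ R^{-i/n}` for all `i`,
`max_{i ≤ n-1} |λ_i| ≥ lam / 2` and `max_{i ≤ n-1} |λ_i| 2^{n-i} R^{i/n} ≥ 1`. -/
noncomputable def taylorCap (n : ℕ) (R lam a : ℝ) : Set (EuclideanSpace ℝ (Fin (n + 1))) :=
  {x | ∃ c : Fin (n + 1) → ℝ,
    x = ∑ i : Fin (n + 1), c i • iteratedDeriv (i : ℕ) (phi n) a ∧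
    (∀ i : Fin (n + 1), |c i| ≤ R ^ (-((i : ℝ) / (n : ℝ)))) ∧
    (∃ i : Fin (n + 1), (i : ℕ) < n ∧ lam / 2 ≤ |c i|) ∧
    (∃ i : Fin (n + 1), (i : ℕ) < n ∧
      1 ≤ |c i| * 2 ^ (n - (i : ℕ)) * R ^ ((i : ℝ) / (n : ℝ)))}

/-- The indices `k` of the caps `θ` at scale `R = 2^{nM}` whose interval `I(θ)` is contained in the
`j`-th interval `J` of `𝒥(r^{-1/n})`, `r = 2^{nm}`. -/
noncomputable def capsIn (n M m j : ℕ) : Finset (Fin (gridCount n M)) :=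
  (Set.toFinite {k : Fin (gridCount n M) | gridInterval n M k ⊆ gridInterval n m j}).toFinset

/-- Admissible bump functions `ψ` on `ℝ^N` for the construction of the weights. -/
structure IsWeightBump {N : ℕ} (ψ : EuclideanSpace ℝ (Fin N) → ℝ) : Prop where
  smooth : ContDiff ℝ ∞ ψ
  nonneg : ∀ ξ, 0 ≤ ψ ξ
  radial : ∀ ξ η, ‖ξ‖ = ‖η‖ → ψ ξ = ψ η
  supp : tsupport ψ ⊆ Metric.closedBall 0 1
  inv_ne_zero : ∀ x : EuclideanSpace ℝ (Fin N), ‖x‖ ≤ 1 → 0 < ‖𝓕⁻ (fun ξ => (ψ ξ : ℂ)) x‖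

/-- `W^{N,d}(x) = ∑_{j ≥ 0} 2^{-100 N² j d} |ψ̌(2^{-j} x)|²`. -/
noncomputable def weight {N : ℕ} (ψ : EuclideanSpace ℝ (Fin N) → ℝ) (d : ℕ)
    (x : EuclideanSpace ℝ (Fin N)) : ℝ :=
  ∑' j : ℕ, (2 ^ (100 * N ^ 2 * j * d) : ℝ)⁻¹ *
    ‖𝓕⁻ (fun ξ => (ψ ξ : ℂ)) (((2 : ℝ) ^ j)⁻¹ • x)‖ ^ 2

/-- The weight `W_B^{N,d} = W^{N,d} ∘ T⁻¹` for the ball `B` with centre `c` and radius `ρ`, which is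
the image of the unit ball under `T y = ρ y + c`. -/
noncomputable def ballWeight {N : ℕ} (ψ : EuclideanSpace ℝ (Fin N) → ℝ) (d : ℕ)
    (c : EuclideanSpace ℝ (Fin N)) (ρ : ℝ) (x : EuclideanSpace ℝ (Fin N)) : ℝ :=
  weight ψ d (ρ⁻¹ • (x - c))

/-! The weight is a series of terms `|ȟ|²` with `h` supported in a ball of radius at most `λ/r`. For
one such term, Plancherel turns the claim into an estimate for the functions `F̂_J * h`, where `F_J`
is the sum of the `f_θ` with `I(θ) ⊆ J`. By Cauchy–Schwarz it suffices that each frequency `x` lies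
within `λ/r` of caps from boundedly many `J` (`exists_overlap_bound`).

For this overlap bound, `x` is encoded as a polynomial `P` of degree at most `n`, whose derivatives
at `a` are, up to sign, the coordinates of `x` in the basis `φ_n^{(i)}(a)`. If `x` is near the cap
at `a`, then `|P(a)| ≤ ε` with `ε = R⁻¹ + (n+1)λ/r`, while some derivatives of order between `1` and
`n` are large at `a`. By Markov's inequality, `|P| ≤ ε` then fails somewhere on any interval of
length `L = 2^κ r^{-1/n}` containing `a`, for a `κ` depending only on `n`. On such an interval `|P|`
therefore crosses the level `ε`, which happens on at most `2n` intervals of a grid, and each of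
these contains boundedly many `J`. -/

/-! ### Markov's inequality for polynomials -/

theorem Polynomial.eval_iterate_derivative_comp_affine (P : Polynomial ℝ) (u L s : ℝ) (j : ℕ) :
    (Polynomial.derivative^[j] (P.comp (Polynomial.C u + Polynomial.C L * Polynomial.X))).eval s =
      L ^ j * (Polynomial.derivative^[j] P).eval (u + L * s) := by
  induction j generalizing P with
  | zero => simp
  | succ j ih =>
    simp only [Function.iterate_succ, Function.comp_apply]
    rw [Polynomial.derivative_comp]
    have h : Polynomial.derivative (Polynomial.C u + Polynomial.C L * Polynomial.X) =
        Polynomial.C L := by simp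
    rw [h, Polynomial.iterate_derivative_C_mul, Polynomial.eval_mul, Polynomial.eval_C, ih]
    ring

/-- Markov's inequality, with an unspecified constant. -/
theorem Polynomial.exists_markov_bound (n : ℕ) :
    ∃ A : ℝ, 0 < A ∧ ∀ (u L ε : ℝ) (P : Polynomial ℝ), 0 < L → P.natDegree ≤ n →
      (∀ t ∈ Set.Ico u (u + L), |P.eval t| ≤ ε) →
      ∀ t ∈ Set.Ico u (u + L), ∀ j : ℕ, |(Polynomial.derivative^[j] P).eval t| * L ^ j ≤ A * ε := by
  have hcont (p : Polynomial ℝ) : ∃ B : ℝ, ∀ s ∈ Set.Icc (0 : ℝ) 1, |p.eval s| ≤ B :=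
    isCompact_Icc.exists_bound_of_continuousOn p.continuous.continuousOn
  choose B hB using hcont
  -- Interpolation nodes in `[0, 1)`: avoiding `1` keeps their images inside the half-open interval
  -- where `P` is controlled.
  let v : ℕ → ℝ := fun m => m / (n + 1 : ℝ)
  have hn : (0 : ℝ) < n + 1 := by positivity
  have hinj : Set.InjOn v (Finset.range (n + 1)) := by
    intro a _ b _ hab
    have := (div_left_inj' hn.ne').1 hab
    exact_mod_cast this
  let l : ℕ → Polynomial ℝ := fun m => Lagrange.basis (Finset.range (n + 1)) v m
  let b : ℕ → ℕ → ℝ := fun j m => B (Polynomial.derivative^[j] (l m))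
  have hb (j m : ℕ) : 0 ≤ b j m := (abs_nonneg _).trans (hB _ 0 (by simp))
  refine ⟨1 + ∑ j ∈ Finset.range (n + 1), ∑ m ∈ Finset.range (n + 1), b j m, ?_, ?_⟩
  · have : 0 ≤ ∑ j ∈ Finset.range (n + 1), ∑ m ∈ Finset.range (n + 1), b j m :=
      Finset.sum_nonneg fun j _ => Finset.sum_nonneg fun m _ => hb j m
    linarith
  intro u L ε P hL hP hε t ht j
  have hε0 : 0 ≤ ε := (abs_nonneg _).trans (hε t ht)
  have hsum (j : ℕ) : 0 ≤ ∑ m ∈ Finset.range (n + 1), b j m :=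
    Finset.sum_nonneg fun m _ => hb j m
  by_cases hj : j ≤ n
  swap
  · rw [Polynomial.iterate_derivative_eq_zero (by omega)]
    have := Finset.sum_nonneg fun j (_ : j ∈ Finset.range (n + 1)) => hsum j
    simp only [Polynomial.eval_zero, abs_zero, zero_mul]
    positivity
  -- Rescaling to `[0, 1]` produces the factor `L ^ j`; there `q` is its own Lagrange interpolant,
  -- with nodal values bounded by `ε`.
  let q := P.comp (Polynomial.C u + Polynomial.C L * Polynomial.X)
  have hq : q.natDegree ≤ n := by
    refine Polynomial.natDegree_comp_le.trans ?_
    have : (Polynomial.C u + Polynomial.C L * Polynomial.X).natDegree ≤ 1 := by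
      rw [add_comm]; exact Polynomial.natDegree_linear_le
    nlinarith
  have hdeg : q.degree < (Finset.range (n + 1)).card := by
    rw [Finset.card_range]
    exact (Polynomial.degree_le_natDegree).trans_lt (by exact_mod_cast Nat.lt_succ_of_le hq)
  have hint := Lagrange.eq_interpolate hinj hdeg
  have hs : (t - u) / L ∈ Set.Icc (0 : ℝ) 1 := by
    refine ⟨div_nonneg (by linarith [ht.1]) hL.le, ?_⟩
    rw [div_le_one hL]; linarith [ht.2]
  have hval : |(Polynomial.derivative^[j] q).eval ((t - u) / L)| ≤
      ∑ m ∈ Finset.range (n + 1), b j m * ε := by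
    rw [hint, Lagrange.interpolate_apply, Polynomial.iterate_derivative_sum,
      Polynomial.eval_finsetSum]
    refine (Finset.abs_sum_le_sum_abs _ _).trans (Finset.sum_le_sum fun m hm => ?_)
    rw [Polynomial.iterate_derivative_C_mul, Polynomial.eval_mul, Polynomial.eval_C, abs_mul,
      mul_comm]
    refine mul_le_mul (hB _ _ hs) ?_ (abs_nonneg _) (hb j m)
    have : Polynomial.eval (v m) q = P.eval (u + L * v m) := by simp [q]
    rw [this]
    refine hε _ ⟨?_, ?_⟩
    · have : 0 ≤ L * v m := by positivity
      linarith
    · have h1 : v m < 1 := by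
        rw [div_lt_one hn]
        exact_mod_cast Finset.mem_range.1 hm
      nlinarith
  rw [Polynomial.eval_iterate_derivative_comp_affine, abs_mul, abs_of_nonneg (by positivity),
    ← Finset.sum_mul, mul_div_cancel₀ _ hL.ne', add_sub_cancel, mul_comm] at hval
  refine hval.trans (mul_le_mul_of_nonneg_right ?_ hε0)
  have := Finset.single_le_sum (fun j _ => hsum j) (Finset.mem_range.2 (Nat.lt_succ_of_le hj))
  linarith

/-! ### The polynomial attached to a frequency -/

/-- The polynomial `∑ k, x k * X ^ (n - k) / (n - k)!` attached to a vector `x`. Its derivatives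
at `-a` are the coordinates of `x` in the basis `φ_n^{(i)}(a)`. -/
noncomputable def capPoly {n : ℕ} (x : EuclideanSpace ℝ (Fin (n + 1))) : Polynomial ℝ :=
  ∑ k : Fin (n + 1), Polynomial.C (x k / ((n - k : ℕ).factorial : ℝ)) * Polynomial.X ^ (n - k : ℕ)

theorem capPoly_add {n : ℕ} (x y : EuclideanSpace ℝ (Fin (n + 1))) :
    capPoly (x + y) = capPoly x + capPoly y := by
  simp only [capPoly, ← Finset.sum_add_distrib]
  refine Finset.sum_congr rfl fun k _ => ?_
  rw [← add_mul, ← Polynomial.C_add, ← add_div, PiLp.add_apply]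

theorem capPoly_smul {n : ℕ} (c : ℝ) (x : EuclideanSpace ℝ (Fin (n + 1))) :
    capPoly (c • x) = c • capPoly x := by
  simp only [capPoly, Finset.smul_sum]
  refine Finset.sum_congr rfl fun k _ => ?_
  rw [Polynomial.smul_eq_C_mul, ← mul_assoc, ← Polynomial.C_mul, PiLp.smul_apply, smul_eq_mul,
    mul_div_assoc]

theorem natDegree_capPoly_le {n : ℕ} (x : EuclideanSpace ℝ (Fin (n + 1))) :
    (capPoly x).natDegree ≤ n := by
  refine Polynomial.natDegree_sum_le_of_forall_le _ _ fun k _ => ?_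
  exact (Polynomial.natDegree_C_mul_X_pow_le _ _).trans (Nat.sub_le _ _)

/-- `capPoly` followed by evaluation at `t`, as a continuous linear functional. -/
noncomputable def capPolyEval (n : ℕ) (t : ℝ) : EuclideanSpace ℝ (Fin (n + 1)) →L[ℝ] ℝ :=
  LinearMap.toContinuousLinearMap
    { toFun := fun x => (capPoly x).eval t
      map_add' := fun x y => by rw [capPoly_add, Polynomial.eval_add]
      map_smul' := fun c x => by rw [capPoly_smul, Polynomial.eval_smul]; rfl }

theorem capPolyEval_apply (n : ℕ) (t : ℝ) (x : EuclideanSpace ℝ (Fin (n + 1))) :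
    capPolyEval n t x = (capPoly x).eval t := rfl

theorem contDiff_phi (n : ℕ) : ContDiff ℝ ∞ (phi n) := by
  unfold phi
  rw [contDiff_piLp]
  intro k
  simp only
  fun_prop

/-- This is the binomial theorem. Since `a` and `t` enter only through `a + t`, differentiating the
curve in `a` amounts to differentiating the polynomial. -/
theorem capPolyEval_phi (n : ℕ) (t a : ℝ) :
    capPolyEval n t (phi n a) = (a + t) ^ n / (n.factorial : ℝ) := by
  rw [capPolyEval_apply, capPoly, Polynomial.eval_finsetSum, add_pow, Finset.sum_div,
    ← Fin.sum_univ_eq_sum_range (fun k => a ^ k * t ^ (n - k) * (n.choose k : ℝ) / n.factorial)]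
  refine Finset.sum_congr rfl fun k _ => ?_
  have hk : (k : ℕ) ≤ n := Nat.lt_succ_iff.1 k.2
  rw [Nat.cast_choose ℝ hk]
  have h1 : ((k : ℕ).factorial : ℝ) ≠ 0 := by positivity
  have h2 : ((n - k : ℕ).factorial : ℝ) ≠ 0 := by positivity
  have h3 : (n.factorial : ℝ) ≠ 0 := by positivity
  simp only [phi, Polynomial.eval_mul, Polynomial.eval_C, Polynomial.eval_pow, Polynomial.eval_X]
  field_simp

theorem capPoly_iteratedDeriv_phi (n i : ℕ) (hi : i ≤ n) (a : ℝ) :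
    capPoly (iteratedDeriv i (phi n) a) =
      Polynomial.C ((n - i).factorial : ℝ)⁻¹ * (Polynomial.X + Polynomial.C a) ^ (n - i) := by
  refine Polynomial.funext fun t => ?_
  have h : iteratedDeriv i (fun a => capPolyEval n t (phi n a)) a =
      capPolyEval n t (iteratedDeriv i (phi n) a) := by
    have := (capPolyEval n t).iteratedFDeriv_comp_left (f := phi n) (x := a) (i := i)
      ((contDiff_phi n).contDiffAt (x := a)) (by exact_mod_cast le_top)
    rw [iteratedDeriv, iteratedDeriv]
    change iteratedFDeriv ℝ i (capPolyEval n t ∘ phi n) a _ = _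
    rw [this]
    rfl
  rw [← capPolyEval_apply, ← h]
  simp only [capPolyEval_phi]
  rw [iteratedDeriv_div_const, iteratedDeriv_comp_add_const i (fun x : ℝ => x ^ n) t]
  beta_reduce
  rw [iteratedDeriv_pow]
  have h1 : ((n - i).factorial : ℝ) ≠ 0 := by positivity
  have h3 : (n.factorial : ℝ) ≠ 0 := by positivity
  have h4 : ((n - i).factorial : ℝ) * n.descFactorial i = n.factorial := by
    exact_mod_cast Nat.factorial_mul_descFactorial hi
  simp only [Polynomial.eval_mul, Polynomial.eval_C, Polynomial.eval_pow, Polynomial.eval_add,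
    Polynomial.eval_X]
  rw [← h4]
  have h5 : (n.descFactorial i : ℝ) ≠ 0 := by
    intro h0; rw [h0] at h4; simp at h4; exact h3 h4.symm
  rw [add_comm t a]
  field_simp

theorem eval_iterate_derivative_X_add_C_pow (a : ℝ) (m j : ℕ) :
    (Polynomial.derivative^[j] ((Polynomial.X + Polynomial.C a) ^ m)).eval (-a) =
      if j = m then (m.factorial : ℝ) else 0 := by
  rw [Polynomial.iterate_derivative_X_add_pow]
  simp only [Polynomial.eval_smul, Polynomial.eval_pow, Polynomial.eval_add, Polynomial.eval_X,
    Polynomial.eval_C, neg_add_cancel]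
  rcases lt_trichotomy j m with h | h | h
  · rw [zero_pow (by omega), if_neg h.ne]; simp
  · subst h; simp [Nat.descFactorial_self]
  · rw [Nat.descFactorial_of_lt h, if_neg h.ne']; simp

theorem capPoly_sum_smul {n : ℕ} (c : Fin (n + 1) → ℝ)
    (y : Fin (n + 1) → EuclideanSpace ℝ (Fin (n + 1))) :
    capPoly (∑ i, c i • y i) = ∑ i, c i • capPoly (y i) := by
  refine Polynomial.funext fun t => ?_
  rw [← capPolyEval_apply, map_sum, Polynomial.eval_finsetSum]
  refine Finset.sum_congr rfl fun i _ => ?_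
  rw [map_smul, Polynomial.eval_smul, capPolyEval_apply]

/-- The vector `φ_n^{(k)}(a)` corresponds to `(X + a)^{n-k} / (n-k)!`, whose only nonzero derivative
at `-a` is the one of order `n - k`, equal to `1`. -/
theorem eval_iterate_derivative_capPoly_sum {n : ℕ} (c : Fin (n + 1) → ℝ) (a : ℝ)
    (i : Fin (n + 1)) :
    (Polynomial.derivative^[n - i] (capPoly (∑ i : Fin (n + 1),
      c i • iteratedDeriv (i : ℕ) (phi n) a))).eval (-a) = c i := by
  rw [capPoly_sum_smul, Polynomial.iterate_derivative_sum, Polynomial.eval_finsetSum,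
    Finset.sum_eq_single i]
  · rw [capPoly_iteratedDeriv_phi n i (by omega), Polynomial.iterate_derivative_smul,
      Polynomial.iterate_derivative_C_mul, Polynomial.eval_smul, Polynomial.eval_mul,
      eval_iterate_derivative_X_add_C_pow, if_pos rfl, Polynomial.eval_C,
      inv_mul_cancel₀ (by positivity), smul_eq_mul, mul_one]
  · intro k _ hk
    have : n - (i : ℕ) ≠ n - k := by
      intro h; apply hk; ext; omega
    rw [capPoly_iteratedDeriv_phi n k (by omega), Polynomial.iterate_derivative_smul,
      Polynomial.iterate_derivative_C_mul, Polynomial.eval_smul, Polynomial.eval_mul,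
      eval_iterate_derivative_X_add_C_pow, if_neg this, mul_zero, smul_zero]
  · simp

/-- Controls the effect of moving `x` off a cap by a small vector: all coordinates change by at most
`(n + 1)` times its norm. -/
theorem abs_eval_iterate_derivative_capPoly_le {n : ℕ} (x : EuclideanSpace ℝ (Fin (n + 1)))
    (t : ℝ) (ht : |t| ≤ 1) (j : ℕ) :
    |(Polynomial.derivative^[j] (capPoly x)).eval t| ≤ (n + 1) * ‖x‖ := by
  rw [capPoly, Polynomial.iterate_derivative_sum, Polynomial.eval_finsetSum]
  refine (Finset.abs_sum_le_sum_abs _ _).trans ?_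
  have : ∀ k ∈ (Finset.univ : Finset (Fin (n + 1))), |(Polynomial.derivative^[j]
      (Polynomial.C (x k / ((n - k : ℕ).factorial : ℝ)) * Polynomial.X ^ (n - k : ℕ))).eval t| ≤
      ‖x‖ := by
    intro k _
    rw [Polynomial.iterate_derivative_C_mul, Polynomial.iterate_derivative_X_pow_eq_smul]
    simp only [Polynomial.eval_mul, Polynomial.eval_C, Polynomial.eval_smul, Polynomial.eval_pow,
      Polynomial.eval_X, smul_eq_mul]
    rw [abs_mul, abs_div, abs_mul, abs_pow, Nat.abs_cast, Nat.abs_cast]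
    have h1 : (0 : ℝ) < ((n - k : ℕ).factorial : ℝ) := by positivity
    have h2 : ((n - k : ℕ).descFactorial j : ℝ) ≤ ((n - k : ℕ).factorial : ℝ) := by
      rcases le_or_gt j (n - k : ℕ) with h | h
      · exact_mod_cast Nat.le_of_dvd (Nat.factorial_pos _)
          ⟨_, (Nat.factorial_mul_descFactorial h).symm.trans (mul_comm _ _)⟩
      · rw [Nat.descFactorial_of_lt h, Nat.cast_zero]; exact h1.le
    have h3 : |t| ^ (n - k - j : ℕ) ≤ 1 := pow_le_one₀ (abs_nonneg _) ht
    have h4 : |x k| ≤ ‖x‖ := PiLp.norm_apply_le x k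
    calc |x k| / ((n - k : ℕ).factorial : ℝ) *
          (((n - k : ℕ).descFactorial j : ℝ) * |t| ^ (n - k - j : ℕ))
        ≤ |x k| / ((n - k : ℕ).factorial : ℝ) * (((n - k : ℕ).factorial : ℝ) * 1) := by gcongr
      _ = |x k| := by field_simp
      _ ≤ ‖x‖ := h4
  refine (Finset.sum_le_card_nsmul _ _ _ this).trans ?_
  simp

/-! ### Sublevel sets and bounded overlap of caps -/

/-- Only `2n` intervals of a grid meet `{|P| ≤ ε}` without being contained in it, since each of
them contains a root of `P² - ε²`. -/
theorem Polynomial.card_partial_sublevel_intervals_le {n : ℕ} (P : Polynomial ℝ) (ε L : ℝ)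
    (hL : 0 < L) (hP : P.natDegree ≤ n) (S : Finset ℕ)
    (hS : ∀ i ∈ S, (∃ t ∈ Set.Ico (i * L) ((i + 1) * L), |P.eval t| ≤ ε) ∧
      ∃ t ∈ Set.Ico (i * L) ((i + 1) * L), ε < |P.eval t|) :
    S.card ≤ 2 * n := by
  rcases S.eq_empty_or_nonempty with rfl | ⟨i₀, hi₀⟩
  · simp
  obtain ⟨⟨t₁, -, h₁⟩, ⟨t₂, -, h₂⟩⟩ := hS i₀ hi₀
  have hε : 0 ≤ ε := (abs_nonneg _).trans h₁
  let Q : Polynomial ℝ := P ^ 2 - Polynomial.C (ε ^ 2)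
  have hQ0 : Q ≠ 0 := by
    intro h
    have : Q.eval t₂ = 0 := by rw [h, Polynomial.eval_zero]
    simp only [Q, Polynomial.eval_sub, Polynomial.eval_pow, Polynomial.eval_C] at this
    rw [← sq_abs] at this
    nlinarith
  have hQd : Q.natDegree ≤ 2 * n := by
    rw [Polynomial.natDegree_sub_C]
    exact Polynomial.natDegree_pow_le.trans (by gcongr)
  -- The intermediate value theorem gives a root in each interval, and the root determines the index
  -- by rounding down, so no root serves two intervals.
  have hsub : S ⊆ Q.roots.toFinset.image fun t => ⌊t / L⌋₊ := by
    intro i hi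
    obtain ⟨⟨t₁, ht₁, h₁⟩, ⟨t₂, ht₂, h₂⟩⟩ := hS i hi
    have hpre : IsPreconnected (Set.Ico (i * L) ((i + 1) * L)) := isPreconnected_Ico
    have hmem : ε ∈ Set.Icc |P.eval t₁| |P.eval t₂| := ⟨h₁, h₂.le⟩
    obtain ⟨t, ht, hte⟩ := hpre.intermediate_value (f := fun t => |P.eval t|) ht₁ ht₂
      (by fun_prop) hmem
    refine Finset.mem_image.2 ⟨t, ?_, ?_⟩
    · rw [Multiset.mem_toFinset, Polynomial.mem_roots hQ0, Polynomial.IsRoot]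
      simp only [Q, Polynomial.eval_sub, Polynomial.eval_pow, Polynomial.eval_C]
      rw [← sq_abs]
      simp only at hte
      rw [hte, sub_self]
    · have h0 : 0 ≤ t / L := div_nonneg ((by positivity : 0 ≤ i * L).trans ht.1) hL.le
      rw [Nat.floor_eq_iff h0]
      exact ⟨(le_div_iff₀ hL).2 ht.1, (div_lt_iff₀ hL).2 ht.2⟩
  calc S.card ≤ Q.roots.toFinset.card := (Finset.card_le_card hsub).trans Finset.card_image_le
    _ ≤ Q.roots.card := Multiset.toFinset_card_le _
    _ ≤ Q.natDegree := Polynomial.card_roots' Q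
    _ ≤ 2 * n := hQd

theorem dyadicScale_rpow {n : ℕ} (hn : 1 ≤ n) (M : ℕ) (i : ℕ) :
    dyadicScale n M ^ ((i : ℝ) / (n : ℝ)) = ((2 : ℝ) ^ M) ^ i := by
  have hn' : (n : ℝ) ≠ 0 := by positivity
  rw [dyadicScale, ← Real.rpow_natCast, ← Real.rpow_mul (by norm_num), ← pow_mul,
    ← Real.rpow_natCast 2 (M * i)]
  congr 1
  push_cast
  field_simp

theorem dyadicScale_rpow_neg {n : ℕ} (hn : 1 ≤ n) (M : ℕ) (i : ℕ) :
    dyadicScale n M ^ (-((i : ℝ) / (n : ℝ))) = (((2 : ℝ) ^ M) ^ i)⁻¹ := by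
  rw [Real.rpow_neg (by unfold dyadicScale; positivity), dyadicScale_rpow hn]

theorem gridPoint_eq {n : ℕ} (hn : 1 ≤ n) (M l : ℕ) :
    gridPoint n M l = l * ((2 : ℝ) ^ (100 * n + M))⁻¹ := by
  have := dyadicScale_rpow_neg hn M 1
  rw [Nat.cast_one, pow_one] at this
  rw [gridPoint, this, pow_add, mul_inv]

theorem dyadicScale_eq_pow (n M : ℕ) : dyadicScale n M = ((2 : ℝ) ^ M) ^ n := by
  rw [dyadicScale, ← pow_mul, mul_comm]

/-- The derivatives of `capPoly` at `-a` near a Taylor cap with initial point `a`. -/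
theorem capPoly_near_taylorCap {n : ℕ} (hn : 1 ≤ n) (M : ℕ) {lam a E : ℝ} (ha : |a| ≤ 1)
    {x e : EuclideanSpace ℝ (Fin (n + 1))} (he : (n + 1) * ‖e‖ ≤ E)
    (hx : x - e ∈ taylorCap n (dyadicScale n M) lam a) :
    |(capPoly x).eval (-a)| ≤ (((2 : ℝ) ^ M) ^ n)⁻¹ + E ∧
    (∃ j : ℕ, 1 ≤ j ∧ j ≤ n ∧
      lam / 2 - E ≤ |(Polynomial.derivative^[j] (capPoly x)).eval (-a)|) ∧
    ∃ j : ℕ, 1 ≤ j ∧ j ≤ n ∧ ((2 : ℝ) ^ M / 2) ^ j * (((2 : ℝ) ^ M) ^ n)⁻¹ - E ≤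
      |(Polynomial.derivative^[j] (capPoly x)).eval (-a)| := by
  obtain ⟨c, hc, hbox, ⟨i₁, hi₁, h₁⟩, ⟨i₂, hi₂, h₂⟩⟩ := hx
  have hd (i : Fin (n + 1)) : ∃ z : ℝ, |z| ≤ E ∧
      (Polynomial.derivative^[n - i] (capPoly x)).eval (-a) = c i + z := by
    refine ⟨(Polynomial.derivative^[n - i] (capPoly e)).eval (-a), ?_, ?_⟩
    · exact (abs_eval_iterate_derivative_capPoly_le e (-a) (by rwa [abs_neg]) _).trans he
    · rw [← eval_iterate_derivative_capPoly_sum c a i, ← hc, ← Polynomial.eval_add,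
        ← iterate_map_add Polynomial.derivative, ← capPoly_add, sub_add_cancel]
  have hge (i : Fin (n + 1)) : |c i| - E ≤
      |(Polynomial.derivative^[n - i] (capPoly x)).eval (-a)| := by
    obtain ⟨z, hz, h⟩ := hd i
    have := abs_sub_abs_le_abs_sub (c i) (-z)
    rw [abs_neg, sub_neg_eq_add] at this
    rw [h]
    linarith
  refine ⟨?_, ⟨n - i₁, by omega, by omega, ?_⟩, ⟨n - i₂, by omega, by omega, ?_⟩⟩
  · obtain ⟨z, hz, h⟩ := hd (Fin.last n)
    have hb := hbox (Fin.last n)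
    rw [dyadicScale_rpow_neg hn] at hb
    simp only [Fin.val_last, Nat.sub_self, Function.iterate_zero, id_eq] at h hb
    rw [h]
    exact (abs_add_le _ _).trans (add_le_add hb hz)
  · exact (sub_le_sub_right h₁ _).trans (hge i₁)
  · refine (sub_le_sub_right ?_ _).trans (hge i₂)
    rw [dyadicScale_rpow hn] at h₂
    have hT : (0 : ℝ) < 2 ^ M := by positivity
    generalize (2 : ℝ) ^ M = T at *
    -- With `j = n - i₂`, the bound `|c i₂| ≥ 2^{-j} T^{-i₂}` becomes `(T / 2)^j T^{-n}`.
    have hn2 : T ^ n = T ^ (i₂ : ℕ) * T ^ (n - i₂ : ℕ) := by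
      rw [← pow_add]; congr 1; omega
    rw [hn2, div_pow, ← div_eq_mul_inv, div_div, div_le_iff₀ (by positivity)]
    calc T ^ (n - i₂ : ℕ) = 1 * T ^ (n - i₂ : ℕ) := (one_mul _).symm
      _ ≤ (|c i₂| * 2 ^ (n - i₂ : ℕ) * T ^ (i₂ : ℕ)) * T ^ (n - i₂ : ℕ) := by gcongr
      _ = _ := by ring

/-- A polynomial with a large derivative at `s`, in the sense of the two lower bounds satisfied
near Taylor caps, is not uniformly small on an interval around `s` which is long compared to
`τ⁻¹`. -/
theorem not_sublevel_of_large_derivatives {n : ℕ} {A lam T τ X D₁ D₂ : ℝ} {j₁ j₂ : ℕ}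
    (hA : 0 < A) (hlam : 0 < lam) (hτ : 1 ≤ τ) (hτT : τ ≤ T) (hT : 4 ≤ T)
    (hτn : 4 * (n + 1) ≤ τ ^ n) (hX : 8 * A * (n + 1) < X) (hX2 : 2 ≤ X)
    (hj₁ : 1 ≤ j₁) (hj₁n : j₁ ≤ n) (hj₂ : 1 ≤ j₂)
    (hD₁ : lam / 2 - (n + 1) * (lam / τ ^ n) ≤ D₁)
    (hD₂ : (T / 2) ^ j₂ * (T ^ n)⁻¹ - (n + 1) * (lam / τ ^ n) ≤ D₂)
    (h₁ : D₁ * (X / τ) ^ j₁ ≤ A * ((T ^ n)⁻¹ + (n + 1) * (lam / τ ^ n)))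
    (h₂ : D₂ * (X / τ) ^ j₂ ≤ A * ((T ^ n)⁻¹ + (n + 1) * (lam / τ ^ n))) : False := by
  have hτ0 : 0 < τ := by linarith
  have hT0 : 0 < T := by linarith
  have hτn0 : 0 < τ ^ n := by positivity
  have hX0 : 0 < X := by linarith
  have hE : (n + 1) * (lam / τ ^ n) ≤ lam / 4 := by
    rw [← mul_div_assoc, div_le_iff₀ hτn0]
    nlinarith
  -- The larger part of `ε` decides which lower bound to use. If the thickening error dominates, `D₁
  -- ≥ lam / 4` contradicts Markov's inequality.
  rcases le_or_gt ((T ^ n)⁻¹) ((n + 1) * (lam / τ ^ n)) with h | h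
  · have hpow : X / τ ^ n ≤ (X / τ) ^ j₁ := by
      rw [div_pow]
      have a1 : X ≤ X ^ j₁ := le_self_pow₀ (by linarith) (by omega)
      have a2 : τ ^ j₁ ≤ τ ^ n := pow_le_pow_right₀ hτ hj₁n
      gcongr
    have hmain : lam / 4 * (X / τ ^ n) ≤ A * (2 * ((n + 1) * (lam / τ ^ n))) := by
      calc lam / 4 * (X / τ ^ n) ≤ D₁ * (X / τ) ^ j₁ := by
            apply mul_le_mul _ hpow (by positivity) <;> linarith
        _ ≤ _ := h₁
        _ ≤ _ := by gcongr; linarith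
    have : lam / (4 * τ ^ n) * X ≤ lam / (4 * τ ^ n) * (8 * A * (n + 1)) := by
      calc _ = lam / 4 * (X / τ ^ n) := by field_simp
        _ ≤ _ := hmain
        _ = _ := by field_simp; ring
    exact absurd (le_of_mul_le_mul_left this (by positivity)) (not_le.2 hX)
  -- If `T^{-n}` dominates, the error costs at most half of the lower bound for `D₂`, and Markov's
  -- inequality would force `X ≤ 8A`.
  · have hT2 : 2 ≤ (T / 2) ^ j₂ :=
      (by linarith : 2 ≤ T / 2).trans (le_self_pow₀ (by linarith) (by omega))
    have hTn : 0 < (T ^ n)⁻¹ := by positivity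
    have hD : (T / 2) ^ j₂ / 2 * (T ^ n)⁻¹ ≤ D₂ := by nlinarith
    have hpow : (X / T) ^ j₂ ≤ (X / τ) ^ j₂ := by gcongr
    have hmain : (T / 2) ^ j₂ / 2 * (T ^ n)⁻¹ * (X / T) ^ j₂ ≤ A * (2 * (T ^ n)⁻¹) := by
      calc _ ≤ D₂ * (X / τ) ^ j₂ := by
            apply mul_le_mul hD hpow (by positivity)
            exact le_trans (by positivity) hD
        _ ≤ _ := h₂
        _ ≤ _ := by gcongr; linarith
    have hXj : X / 2 ≤ (X / 2) ^ j₂ := le_self_pow₀ (by linarith) (by omega)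
    have heq : (T / 2) ^ j₂ / 2 * (T ^ n)⁻¹ * (X / T) ^ j₂ = (T ^ n)⁻¹ * ((X / 2) ^ j₂ / 2) := by
      have : (T / 2) ^ j₂ * (X / T) ^ j₂ = (X / 2) ^ j₂ := by
        rw [← mul_pow]; congr 1; field_simp
      rw [← this]; ring
    rw [heq] at hmain
    have : (X / 2) ^ j₂ / 2 ≤ 2 * A := by
      refine le_of_mul_le_mul_left (hmain.trans_eq ?_) hTn
      ring
    have hn0 : (0 : ℝ) ≤ n := n.cast_nonneg
    nlinarith [mul_nonneg hA.le hn0]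

theorem Nat.card_filter_div_eq_le (N K b : ℕ) (hK : 0 < K) (S : Finset (Fin N)) :
    (S.filter fun j : Fin N => (j : ℕ) / K = b).card ≤ K := by
  have h : ((S.filter fun j : Fin N => (j : ℕ) / K = b).map Fin.valEmbedding) ⊆
      Finset.Ico (b * K) (b * K + K) := by
    intro j hj
    obtain ⟨i, hi, rfl⟩ := Finset.mem_map.1 hj
    have := (Finset.mem_filter.1 hi).2
    have h1 := Nat.div_add_mod (i : ℕ) K
    have h2 := Nat.mod_lt (i : ℕ) hK
    rw [this, mul_comm] at h1
    simp only [Fin.valEmbedding_apply, Finset.mem_Ico]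
    omega
  have := Finset.card_le_card h
  simpa using this

/-- Bounded overlap: a point is within `lam / r` of caps from boundedly many intervals of
`𝒥(r^{-1/n})`. -/
theorem exists_overlap_bound (n : ℕ) (hn : 1 ≤ n) :
    ∃ C : ℕ, ∀ (M m : ℕ), m ≤ M → ∀ lam : ℝ, 0 < lam →
      ∀ (x : EuclideanSpace ℝ (Fin (n + 1))) (S : Finset (Fin (gridCount n m))),
      (∀ j ∈ S, ∃ k : Fin (gridCount n M), gridInterval n M k ⊆ gridInterval n m j ∧
        ∃ e, ‖e‖ ≤ lam / dyadicScale n m ∧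
          x - e ∈ taylorCap n (dyadicScale n M) lam (gridPoint n M k)) →
      S.card ≤ C := by
  obtain ⟨A, hA, hmarkov⟩ := Polynomial.exists_markov_bound n
  -- `2^κ` plays the role of `X` in `not_sublevel_of_large_derivatives`. `K` counts the intervals of
  -- `𝒥(r^{-1/n})` in a coarse interval of length `2^κ r^{-1/n}`.
  obtain ⟨κ, hκ⟩ := pow_unbounded_of_one_lt (8 * A * (n + 1) + 2) (one_lt_two (α := ℝ))
  let K : ℕ := 2 ^ (κ + 100 * n)
  have hK : 0 < K := by positivity
  refine ⟨2 ^ (100 * n + (n + 4)) + K * (2 * n), fun M m hmM lam hlam x S hS => ?_⟩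
  -- For small `r` there are boundedly many `J` in all; otherwise `2^m ≥ 4(n + 1)`, so the
  -- thickening error is at most `lam / 4`.
  rcases lt_or_ge m (n + 4) with hm | hm
  · have h1 : S.card ≤ gridCount n m := by
      simpa using Finset.card_le_univ S
    have h2 : gridCount n m ≤ 2 ^ (100 * n + (n + 4)) :=
      Nat.pow_le_pow_right (by norm_num) (by omega)
    omega
  refine le_trans ?_ (Nat.le_add_left _ _)
  refine (Finset.card_le_mul_card_image (f := fun j : Fin (gridCount n m) => (j : ℕ) / K) S K
    fun b _ => Nat.card_filter_div_eq_le _ K b hK S).trans ?_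
  refine Nat.mul_le_mul_left _ ?_
  let E : ℝ := (n + 1) * (lam / ((2 : ℝ) ^ m) ^ n)
  let ε : ℝ := (((2 : ℝ) ^ M) ^ n)⁻¹ + E
  let L : ℝ := 2 ^ κ / 2 ^ m
  have hL : 0 < L := by positivity
  -- The reflection moves the evaluation point from `-a` to `a`, so that the intervals are those of
  -- the original grid.
  let P : Polynomial ℝ :=
    (capPoly x).comp (Polynomial.C 0 + Polynomial.C (-1) * Polynomial.X)
  have hPe (t : ℝ) (j : ℕ) : |(Polynomial.derivative^[j] P).eval t| =
      |(Polynomial.derivative^[j] (capPoly x)).eval (-t)| := by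
    rw [Polynomial.eval_iterate_derivative_comp_affine, abs_mul, abs_pow, abs_neg, abs_one,
      one_pow, one_mul, zero_add, neg_one_mul]
  have hPd : P.natDegree ≤ n := by
    refine Polynomial.natDegree_comp_le.trans ?_
    have h1 : (Polynomial.C (0 : ℝ) + Polynomial.C (-1) * Polynomial.X).natDegree ≤ 1 := by
      rw [add_comm]; exact Polynomial.natDegree_linear_le
    have h2 := natDegree_capPoly_le x
    nlinarith
  refine Polynomial.card_partial_sublevel_intervals_le P ε L hL hPd _ fun i hi => ?_
  obtain ⟨j, hj, rfl⟩ := Finset.mem_image.1 hi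
  obtain ⟨k, hk, e, he, hx⟩ := hS j hj
  set a := gridPoint n M k with ha_def
  have haI : a ∈ gridInterval n m j := by
    refine hk ⟨le_rfl, ?_⟩
    rw [ha_def, gridPoint_eq hn, gridPoint_eq hn]
    push_cast
    have : (0 : ℝ) < ((2 : ℝ) ^ (100 * n + M))⁻¹ := by positivity
    nlinarith
  have ha1 : |a| ≤ 1 := by
    rw [ha_def, gridPoint_eq hn, abs_of_nonneg (by positivity), ← div_eq_mul_inv,
      div_le_one (by positivity)]
    exact_mod_cast k.2.le
  have haL : a ∈ Set.Ico (((j / K : ℕ) : ℝ) * L) ((((j / K : ℕ) : ℝ) + 1) * L) := by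
    rw [gridInterval, gridPoint_eq hn, gridPoint_eq hn] at haI
    have hδ : (0 : ℝ) < ((2 : ℝ) ^ (100 * n + m))⁻¹ := by positivity
    have hLδ : L = K * ((2 : ℝ) ^ (100 * n + m))⁻¹ := by
      simp only [L, K]
      push_cast
      rw [pow_add, pow_add]
      field_simp
    have h1 : j / K * K ≤ (j : ℕ) := Nat.div_mul_le_self _ _
    have h2 : (j : ℕ) + 1 ≤ (j / K + 1) * K := Nat.lt_mul_of_div_lt (Nat.lt_succ_self _) hK
    have h1' : ((j / K : ℕ) : ℝ) * K ≤ j := by exact_mod_cast h1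
    have h2' : ((j : ℕ) + 1 : ℝ) ≤ (((j / K : ℕ) : ℝ) + 1) * K := by exact_mod_cast h2
    rw [hLδ, ← mul_assoc, ← mul_assoc]
    refine ⟨(mul_le_mul_of_nonneg_right h1' hδ.le).trans haI.1,
      haI.2.trans_le ?_⟩
    push_cast
    exact mul_le_mul_of_nonneg_right h2' hδ.le
  rw [dyadicScale_eq_pow n m] at he
  obtain ⟨hc₀, ⟨j₁, hj₁, hj₁n, hc₁⟩, ⟨j₂, hj₂, hj₂n, hc₂⟩⟩ := capPoly_near_taylorCap hn M
    (E := E) ha1 (mul_le_mul_of_nonneg_left he (by positivity)) hx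
  refine ⟨⟨a, haL, ?_⟩, ?_⟩
  · have := hPe a 0
    simp only [Function.iterate_zero, id_eq] at this
    rwa [this]
  -- Were the whole coarse interval in the sublevel set, Markov's inequality at `a` would contradict
  -- the large derivatives there.
  by_contra! hcon
  rw [add_mul, one_mul] at hcon haL
  have hbd := hmarkov _ L ε P hL hPd hcon a haL
  have hm1 : (1 : ℝ) ≤ 2 ^ m := one_le_pow₀ (by norm_num)
  have hmn : (4 : ℝ) * (n + 1) ≤ 2 ^ m := by
    have h1 : (2 : ℝ) ^ (n + 4) ≤ 2 ^ m := pow_le_pow_right₀ (by norm_num) hm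
    have h2 : ((n + 1 : ℕ) : ℝ) ≤ 2 ^ n := by exact_mod_cast Nat.lt_two_pow_self
    rw [pow_add] at h1
    push_cast at h2
    linarith
  have hmM' : (2 : ℝ) ^ m ≤ 2 ^ M := pow_le_pow_right₀ (by norm_num) hmM
  have hn0 : (0 : ℝ) ≤ n := n.cast_nonneg
  refine not_sublevel_of_large_derivatives (n := n) hA hlam hm1 hmM' (by linarith)
    (hmn.trans (le_self_pow₀ hm1 (by omega))) (by linarith) (X := 2 ^ κ) ?_ hj₁ hj₁n hj₂
    hc₁ hc₂ ?_ ?_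
  · have : 0 ≤ 8 * A * (n + 1) := by positivity
    linarith
  · rw [← hPe]; exact hbd j₁
  · rw [← hPe]; exact hbd j₂

/-! ### Almost orthogonality by Plancherel -/

section Fourier

variable {V : Type*} [NormedAddCommGroup V] [InnerProductSpace ℝ V] [FiniteDimensional ℝ V]
  [MeasurableSpace V] [BorelSpace V]

open MeasureTheory SchwartzMap

/-- Multiplying by the localising factor `ȟ` thickens the Fourier support by that of `h`. -/
theorem fourierInv_convolution_fourier (f h : SchwartzMap V ℂ) (x : V) :
    𝓕⁻ (SchwartzMap.convolution (ContinuousLinearMap.mul ℂ ℂ) (𝓕 f) h) x =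
      f x * 𝓕⁻ h x := by
  have hf : 𝓕 (𝓕 f) (-x) = f x := by
    rw [SchwartzMap.fourier_coe, ← Real.fourierInv_eq_fourier_neg, ← SchwartzMap.fourierInv_coe,
      FourierTransform.fourierInv_fourier_eq]
  rw [SchwartzMap.fourierInv_coe, Real.fourierInv_eq_fourier_neg, ← SchwartzMap.fourier_coe,
    SchwartzMap.fourier_convolution, SchwartzMap.pairing_apply_apply, hf,
    SchwartzMap.fourierInv_coe, Real.fourierInv_eq_fourier_neg, ← SchwartzMap.fourier_coe]
  rfl

theorem exists_ne_zero_of_convolution_ne_zero (f h : SchwartzMap V ℂ) (ξ : V)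
    (hξ : SchwartzMap.convolution (ContinuousLinearMap.mul ℂ ℂ) f h ξ ≠ 0) :
    ∃ e, h e ≠ 0 ∧ f (ξ - e) ≠ 0 := by
  by_contra! hcon
  apply hξ
  rw [SchwartzMap.convolution_apply, MeasureTheory.convolution]
  refine integral_eq_zero_of_ae (Filter.Eventually.of_forall fun t => ?_)
  by_cases ht : h (ξ - t) = 0
  · simp [ht]
  · have := hcon _ ht
    rw [sub_sub_cancel] at this
    simp [this]

theorem SchwartzMap.integrable_norm_sq (f : SchwartzMap V ℂ) :
    Integrable fun x => ‖f x‖ ^ 2 :=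
  (f.memLp 2 volume).integrable_norm_pow (by norm_num)

theorem norm_sum_sq_le_mul_sum_norm_sq {ι : Type*} [Fintype ι] (z : ι → ℂ) (C : ℕ)
    (h : ∀ S : Finset ι, (∀ j ∈ S, z j ≠ 0) → S.card ≤ C) :
    ‖∑ j, z j‖ ^ 2 ≤ C * ∑ j, ‖z j‖ ^ 2 := by
  classical
  let S : Finset ι := Finset.univ.filter fun j => z j ≠ 0
  have hS : S.card ≤ C := h S fun j hj => (Finset.mem_filter.1 hj).2
  have h1 : ∑ j, z j = ∑ j ∈ S, z j := (Finset.sum_filter_ne_zero _).symm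
  calc ‖∑ j, z j‖ ^ 2 ≤ (∑ j ∈ S, ‖z j‖) ^ 2 := by
        rw [h1]; gcongr; exact norm_sum_le _ _
    _ ≤ S.card * ∑ j ∈ S, ‖z j‖ ^ 2 := sq_sum_le_card_mul_sum_sq
    _ ≤ C * ∑ j, ‖z j‖ ^ 2 := by
        gcongr
        exact Finset.subset_univ S

/-- Local orthogonality: if the `h`-neighbourhoods of the Fourier supports of the `F j` overlap at
most `C` times, the `F j` are almost orthogonal with respect to the weight `|𝓕⁻ h|²`. -/
theorem integral_norm_sum_sq_mul_le {ι : Type*} [Fintype ι] (F : ι → SchwartzMap V ℂ)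
    (h : SchwartzMap V ℂ) (C : ℕ)
    (hC : ∀ (ξ : V) (S : Finset ι), (∀ j ∈ S, ∃ e, h e ≠ 0 ∧ 𝓕 (F j) (ξ - e) ≠ 0) →
      S.card ≤ C) :
    ∫ x, ‖∑ j, F j x‖ ^ 2 * ‖𝓕⁻ h x‖ ^ 2 ≤
      C * ∫ x, (∑ j, ‖F j x‖ ^ 2) * ‖𝓕⁻ h x‖ ^ 2 := by
  let G : ι → SchwartzMap V ℂ := fun j =>
    SchwartzMap.convolution (ContinuousLinearMap.mul ℂ ℂ) (𝓕 (F j)) h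
  have hpl (g : SchwartzMap V ℂ) : ∫ x, ‖𝓕⁻ g x‖ ^ 2 = ∫ ξ, ‖g ξ‖ ^ 2 := by
    rw [← SchwartzMap.integral_norm_sq_fourier (𝓕⁻ g), FourierTransform.fourier_fourierInv_eq]
  have hG (j : ι) (x : V) : 𝓕⁻ (G j) x = F j x * 𝓕⁻ h x := fourierInv_convolution_fourier _ _ _
  have hsum (x : V) : 𝓕⁻ (∑ j, G j) x = (∑ j, F j x) * 𝓕⁻ h x := by
    have : 𝓕⁻ (∑ j, G j) = ∑ j, 𝓕⁻ (G j) :=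
      map_sum (FourierTransform.fourierInvCLM ℂ (SchwartzMap V ℂ)) G Finset.univ
    rw [this, sum_apply, Finset.sum_mul]
    exact Finset.sum_congr rfl fun j _ => hG j x
  calc ∫ x, ‖∑ j, F j x‖ ^ 2 * ‖𝓕⁻ h x‖ ^ 2 = ∫ x, ‖𝓕⁻ (∑ j, G j) x‖ ^ 2 := by
        simp_rw [hsum, norm_mul, mul_pow]
    _ = ∫ ξ, ‖∑ j, G j ξ‖ ^ 2 := by
        rw [hpl]; simp_rw [sum_apply]
    _ ≤ ∫ ξ, C * ∑ j, ‖G j ξ‖ ^ 2 := by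
        refine integral_mono_of_nonneg (Filter.Eventually.of_forall fun ξ => by positivity) ?_
          (Filter.Eventually.of_forall fun ξ => ?_)
        · exact (integrable_finsetSum _ fun j _ => (G j).integrable_norm_sq).const_mul _
        · refine norm_sum_sq_le_mul_sum_norm_sq _ C fun S hS => hC ξ S fun j hj => ?_
          exact exists_ne_zero_of_convolution_ne_zero _ _ _ (hS j hj)
    _ = C * ∑ j, ∫ x, ‖𝓕⁻ (G j) x‖ ^ 2 := by
        rw [integral_const_mul, integral_finsetSum _ fun j _ => (G j).integrable_norm_sq]
        simp_rw [hpl]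
    _ = C * ∫ x, ∑ j, ‖𝓕⁻ (G j) x‖ ^ 2 := by
        rw [integral_finsetSum _ fun j _ => (𝓕⁻ (G j)).integrable_norm_sq]
    _ = C * ∫ x, (∑ j, ‖F j x‖ ^ 2) * ‖𝓕⁻ h x‖ ^ 2 := by
        simp_rw [hG, norm_mul, mul_pow, Finset.sum_mul]

/-- The affine rescaling `x ↦ ψ̌(s (x - b))` is the inverse Fourier transform of a Schwartz function
supported in the ball of radius `s`. -/
theorem exists_fourierInv_eq_comp_affine (ψ : V → ℝ) (hψ : ContDiff ℝ ∞ ψ)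
    (hsupp : tsupport ψ ⊆ Metric.closedBall 0 1) (b : V) (s : ℝ) (hs : 0 < s) :
    ∃ h : SchwartzMap V ℂ, (∀ η, h η ≠ 0 → ‖η‖ ≤ s) ∧
      ∀ x, 𝓕⁻ h x = 𝓕⁻ (fun ξ => (ψ ξ : ℂ)) (s • (x - b)) := by
  -- The phase produces the translation by `b`; the factor `s^{-dim}` compensates for the dilation.
  let h₀ : V → ℂ := fun η => ((s ^ Module.finrank ℝ V : ℝ) : ℂ)⁻¹ *
    (Complex.exp (((-2 * Real.pi * inner ℝ η b : ℝ) : ℂ) * Complex.I) * (ψ (s⁻¹ • η) : ℂ))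
  have hne (η : V) (hη : h₀ η ≠ 0) : ‖η‖ ≤ s := by
    have h1 : ψ (s⁻¹ • η) ≠ 0 := by
      intro h; apply hη; simp [h₀, h]
    have h2 := hsupp (subset_tsupport ψ h1)
    rw [mem_closedBall_zero_iff, norm_smul, norm_inv, Real.norm_of_nonneg hs.le,
      inv_mul_le_iff₀ hs, mul_one] at h2
    exact h2
  have hcs : HasCompactSupport h₀ := by
    refine HasCompactSupport.of_support_subset_isCompact (isCompact_closedBall (0 : V) s) ?_
    intro η hη
    exact mem_closedBall_zero_iff.2 (hne η hη)
  have hcd : ContDiff ℝ ∞ h₀ := by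
    refine contDiff_const.mul (ContDiff.mul ?_ ?_)
    · refine Complex.contDiff_exp.comp (ContDiff.mul ?_ contDiff_const)
      exact Complex.ofRealCLM.contDiff.comp
        (contDiff_const.mul (contDiff_id.inner ℝ contDiff_const))
    · exact Complex.ofRealCLM.contDiff.comp (hψ.comp (contDiff_const_smul _))
  refine ⟨hcs.toSchwartzMap hcd, hne, fun x => ?_⟩
  rw [SchwartzMap.fourierInv_coe]
  change 𝓕⁻ h₀ x = _
  rw [Real.fourierInv_eq', Real.fourierInv_eq']
  have key := Measure.integral_comp_inv_smul (volume : Measure V) (fun v : V =>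
    Complex.exp (((2 * Real.pi * inner ℝ v (s • (x - b)) : ℝ) : ℂ) * Complex.I) • (ψ v : ℂ)) s
  have hpos : 0 < s ^ Module.finrank ℝ V := by positivity
  rw [abs_of_pos hpos] at key
  rw [← inv_smul_smul₀ hpos.ne' (∫ v : V, Complex.exp
    (((2 * Real.pi * inner ℝ v (s • (x - b)) : ℝ) : ℂ) * Complex.I) • (ψ v : ℂ)), ← key,
    ← integral_smul]
  refine integral_congr_ae (Filter.Eventually.of_forall fun v => ?_)
  have hin : inner ℝ (s⁻¹ • v) (s • (x - b)) = inner ℝ v x - inner ℝ v b := by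
    rw [real_inner_smul_left, real_inner_smul_right, inner_sub_right, inv_mul_cancel_left₀ hs.ne']
  simp only [hin, h₀, smul_eq_mul, Complex.real_smul, Complex.ofReal_inv]
  rw [mul_left_comm, ← mul_assoc (Complex.exp _), ← Complex.exp_add]
  congr 3
  push_cast
  ring_nf

end Fourier

/-! ### Expansion of the weight, grouping of the caps, and conclusion -/

open MeasureTheory in
/-- Integration against `ballWeight` termwise in the series defining the weight. -/
theorem hasSum_integral_mul_ballWeight {N : ℕ} (hN : 1 ≤ N) {ψ : EuclideanSpace ℝ (Fin N) → ℝ}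
    (hψ : IsWeightBump ψ) {d : ℕ} (hd : 1 ≤ d) (b : EuclideanSpace ℝ (Fin N)) (ρ : ℝ)
    {u : EuclideanSpace ℝ (Fin N) → ℝ} (hu : Integrable u) (hu0 : ∀ x, 0 ≤ u x) :
    HasSum (fun i : ℕ => (2 ^ (100 * N ^ 2 * i * d) : ℝ)⁻¹ *
      ∫ x, u x * ‖𝓕⁻ (fun ξ => (ψ ξ : ℂ)) ((((2 : ℝ) ^ i)⁻¹ * ρ⁻¹) • (x - b))‖ ^ 2)
      (∫ x, u x * ballWeight ψ d b ρ x) := by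
  have hcs : HasCompactSupport fun ξ => (ψ ξ : ℂ) := by
    refine HasCompactSupport.of_support_subset_isCompact
      (isCompact_closedBall (0 : EuclideanSpace ℝ (Fin N)) 1) fun ξ hξ => hψ.supp ?_
    exact subset_tsupport ψ fun h => hξ (by simp [h])
  let Ψ : SchwartzMap (EuclideanSpace ℝ (Fin N)) ℂ :=
    hcs.toSchwartzMap (Complex.ofRealCLM.contDiff.comp hψ.smooth)
  have hΨ (x : EuclideanSpace ℝ (Fin N)) : 𝓕⁻ (fun ξ => (ψ ξ : ℂ)) x = 𝓕⁻ Ψ x := by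
    rw [SchwartzMap.fourierInv_coe]; rfl
  simp_rw [ballWeight, weight, hΨ, smul_smul]
  set g := 𝓕⁻ Ψ
  set B := ‖g.toBoundedContinuousFunction‖ ^ 2
  have hB (x : EuclideanSpace ℝ (Fin N)) : ‖g x‖ ^ 2 ≤ B :=
    pow_le_pow_left₀ (norm_nonneg _) (g.toBoundedContinuousFunction.norm_coe_le_norm x) 2
  let t : ℕ → EuclideanSpace ℝ (Fin N) → ℝ := fun i x =>
    (2 ^ (100 * N ^ 2 * i * d) : ℝ)⁻¹ * (u x * ‖g ((((2 : ℝ) ^ i)⁻¹ * ρ⁻¹) • (x - b))‖ ^ 2)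
  have hint (i : ℕ) :
      Integrable fun x => u x * ‖g ((((2 : ℝ) ^ i)⁻¹ * ρ⁻¹) • (x - b))‖ ^ 2 := by
    refine hu.mul_bdd (c := B) ?_ (Filter.Eventually.of_forall fun x => ?_)
    · have := g.continuous
      exact Continuous.aestronglyMeasurable (by fun_prop)
    · rw [Real.norm_of_nonneg (by positivity)]
      exact hB _
  have ht0 (i : ℕ) (x : EuclideanSpace ℝ (Fin N)) : 0 ≤ t i x :=
    mul_nonneg (by positivity) (mul_nonneg (hu0 x) (by positivity))
  -- The geometric majorant uses that `ψ̌` is bounded and that `100 N² i d ≥ i`, as `N, d ≥ 1`.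
  have hsum : Summable fun i => ∫ x, ‖t i x‖ := by
    refine Summable.of_nonneg_of_le (fun i => integral_nonneg fun x => norm_nonneg _)
      (fun i => ?_) (summable_geometric_two.mul_right (∫ x, u x * B))
    simp_rw [Real.norm_of_nonneg (ht0 i _), t, integral_const_mul]
    refine mul_le_mul ?_ ?_ (integral_nonneg fun x => mul_nonneg (hu0 x) (by positivity))
      (by positivity)
    · rw [one_div, inv_pow]
      refine inv_anti₀ (by positivity) (pow_le_pow_right₀ (by norm_num) ?_)
      have h1 : 1 ≤ 100 * N ^ 2 := Nat.one_le_iff_ne_zero.2 (by positivity)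
      calc i = 1 * i * 1 := by ring
        _ ≤ 100 * N ^ 2 * i * d := by gcongr
    · exact integral_mono (hint i) (hu.mul_const _) fun x =>
        mul_le_mul_of_nonneg_left (hB _) (hu0 x)
  have := hasSum_integral_of_summable_integral_norm (F := t) (fun i => (hint i).const_mul _) hsum
  convert this using 1
  · rfl
  · funext i
    rw [integral_const_mul]
  · refine integral_congr_ae (Filter.Eventually.of_forall fun x => ?_)
    simp only [t]
    rw [← tsum_mul_left]
    refine tsum_congr fun i => ?_
    ring

/-- The grids are nested, each coarse interval being a union of `2^{M-m}` consecutive fine ones;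
hence every cap belongs to exactly one `J`. -/
theorem mem_capsIn_iff {n : ℕ} (hn : 1 ≤ n) {M m : ℕ} (hmM : m ≤ M) (j : ℕ)
    (k : Fin (gridCount n M)) : k ∈ capsIn n M m j ↔ (k : ℕ) / 2 ^ (M - m) = j := by
  have hδ : (0 : ℝ) < ((2 : ℝ) ^ (100 * n + M))⁻¹ := by positivity
  have hscale : ((2 : ℝ) ^ (100 * n + m))⁻¹ =
      ((2 ^ (M - m) : ℕ) : ℝ) * ((2 : ℝ) ^ (100 * n + M))⁻¹ := by
    have : (2 : ℝ) ^ (100 * n + M) = 2 ^ (M - m) * 2 ^ (100 * n + m) := by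
      rw [← pow_add]; congr 1; omega
    rw [this]
    push_cast
    field_simp
  rw [capsIn, Set.Finite.mem_toFinset, Set.mem_ofPred_eq, gridInterval, gridInterval]
  simp only [gridPoint_eq hn, hscale, ← mul_assoc]
  rw [Set.Ico_subset_Ico_iff (mul_lt_mul_of_pos_right (by exact_mod_cast Nat.lt_succ_self _) hδ),
    mul_le_mul_iff_left₀ hδ, mul_le_mul_iff_left₀ hδ, Nat.div_eq_iff (by positivity)]
  norm_cast
  have hD : 0 < 2 ^ (M - m) := by positivity
  generalize 2 ^ (M - m) = D at hD ⊢
  rw [Nat.add_mul, Nat.one_mul]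
  omega

theorem sum_capsIn {n : ℕ} (hn : 1 ≤ n) {M m : ℕ} (hmM : m ≤ M) {A : Type*} [AddCommMonoid A]
    (g : Fin (gridCount n M) → A) :
    ∑ j : Fin (gridCount n m), ∑ k ∈ capsIn n M m j, g k = ∑ k, g k := by
  have hlt (k : Fin (gridCount n M)) : (k : ℕ) / 2 ^ (M - m) < gridCount n m := by
    refine Nat.div_lt_of_lt_mul ?_
    have : gridCount n M = 2 ^ (M - m) * gridCount n m := by
      rw [gridCount, gridCount, ← pow_add]; congr 1; omega
    exact this ▸ k.2
  rw [← Finset.sum_fiberwise Finset.univ (fun k => (⟨_, hlt k⟩ : Fin (gridCount n m))) g]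
  refine Finset.sum_congr rfl fun j _ => Finset.sum_congr ?_ fun _ _ => rfl
  ext k
  rw [mem_capsIn_iff hn hmM, Finset.mem_filter, Fin.ext_iff]
  simp

theorem theorem2p3 (n : ℕ) (hn : 1 ≤ n) :
    ∃ C : ℝ, 0 < C ∧
      ∀ (ψ : EuclideanSpace ℝ (Fin (n + 1)) → ℝ), IsWeightBump ψ →
      ∀ (d : ℕ), 1 ≤ d →
      ∀ (R r : ℝ) (M m : ℕ), R = dyadicScale n M → r = dyadicScale n m → r ≤ R →
      ∀ (lam : ℝ), (∃ q : ℤ, lam = (2 : ℝ) ^ q) →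
        R ^ (-(((n : ℝ) - 1) / (n : ℝ))) ≤ lam → lam ≤ 1 →
      ∀ (b : EuclideanSpace ℝ (Fin (n + 1)))
        (f : Fin (gridCount n M) → SchwartzMap (EuclideanSpace ℝ (Fin (n + 1))) ℂ),
        (∀ k : Fin (gridCount n M),
          tsupport (𝓕 (f k : EuclideanSpace ℝ (Fin (n + 1)) → ℂ)) ⊆
            taylorCap n R lam (gridPoint n M k)) →
        ∫ x, ‖∑ k : Fin (gridCount n M), f k x‖ ^ 2 * ballWeight ψ d b (lam⁻¹ * r) x ≤
          C * ∫ x, (∑ j : Fin (gridCount n m), ‖∑ k ∈ capsIn n M m j, f k x‖ ^ 2) *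
            ballWeight ψ d b (lam⁻¹ * r) x := by
  obtain ⟨C, hC⟩ := exists_overlap_bound n hn
  refine ⟨C + 1, by positivity, ?_⟩
  rintro ψ hψ d hd R r M m rfl rfl hrR lam ⟨q, hq⟩ - - b f hf
  have hlam : 0 < lam := hq ▸ by positivity
  have hmM : m ≤ M := by
    have h1 : n * m ≤ n * M := (pow_le_pow_iff_right₀ one_lt_two).1 hrR
    exact Nat.le_of_mul_le_mul_left h1 hn
  have hr : 0 < dyadicScale n m := by unfold dyadicScale; positivity
  let F : Fin (gridCount n m) → SchwartzMap (EuclideanSpace ℝ (Fin (n + 1))) ℂ :=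
    fun j => ∑ k ∈ capsIn n M m j, f k
  have hF (j : Fin (gridCount n m)) (x : EuclideanSpace ℝ (Fin (n + 1))) :
      ∑ k ∈ capsIn n M m j, f k x = F j x := (sum_apply _ _ _).symm
  have hFsum (x : EuclideanSpace ℝ (Fin (n + 1))) : ∑ k, f k x = ∑ j, F j x := by
    simp_rw [← hF]
    exact (sum_capsIn hn hmM fun k => f k x).symm
  simp_rw [hF, hFsum]
  have hint₁ : MeasureTheory.Integrable fun x => ‖∑ j, F j x‖ ^ 2 := by
    have := (∑ j, F j).integrable_norm_sq
    simpa only [sum_apply] using this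
  have hint₂ : MeasureTheory.Integrable fun x => ∑ j, ‖F j x‖ ^ 2 :=
    MeasureTheory.integrable_finsetSum _ fun j _ => (F j).integrable_norm_sq
  have hs₁ := hasSum_integral_mul_ballWeight (Nat.le_add_left 1 n) hψ hd b
    (lam⁻¹ * dyadicScale n m) hint₁ fun x => by positivity
  have hs₂ := hasSum_integral_mul_ballWeight (Nat.le_add_left 1 n) hψ hd b
    (lam⁻¹ * dyadicScale n m) hint₂ fun x => by positivity
  -- The inequality holds for each term of the weight separately, with a constant independent of
  -- `i`.
  refine hasSum_le (fun i => ?_) hs₁ (hs₂.mul_left _)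
  rw [mul_left_comm]
  refine mul_le_mul_of_nonneg_left ?_ (by positivity)
  obtain ⟨h, hsupp, hh⟩ := exists_fourierInv_eq_comp_affine ψ hψ.smooth hψ.supp b
    (((2 : ℝ) ^ i)⁻¹ * (lam⁻¹ * dyadicScale n m)⁻¹) (by positivity)
  simp_rw [← hh]
  refine (integral_norm_sum_sq_mul_le F h C fun ξ S hS => ?_).trans
    (mul_le_mul_of_nonneg_right (by linarith)
      (MeasureTheory.integral_nonneg fun x => by positivity))
  refine hC M m hmM lam hlam ξ S fun j hj => ?_
  obtain ⟨e, he, hFe⟩ := hS j hj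
  have hfou : 𝓕 (F j) = ∑ k ∈ capsIn n M m j, 𝓕 (f k) :=
    map_sum (FourierTransform.fourierCLM ℂ (SchwartzMap _ ℂ)) f _
  rw [hfou, sum_apply] at hFe
  obtain ⟨k, hk, hfk⟩ := Finset.exists_ne_zero_of_sum_ne_zero hFe
  refine ⟨k, ?_, e, ?_, hf k (subset_tsupport _ hfk)⟩
  · rw [capsIn, Set.Finite.mem_toFinset] at hk
    exact hk
  -- The radius is `2^{-i} λ/r`, so every `i` meets the tolerance `λ/r` of the overlap bound.
  · refine (hsupp e he).trans ?_
    rw [mul_inv, inv_inv, ← div_eq_mul_inv]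
    exact mul_le_of_le_one_left (by positivity) (inv_le_one_of_one_le₀ (one_le_pow₀ one_le_two))
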